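/- Let $0<\rho\le\infty$, $I=(0,\rho)$, and $F:I\to\mathbb R$. Fix $u_0\in(0,1)$ and an integer $N\ge 3$, and let $\mathbf u=(1,u_0,\dots,u_0^{N-1})^T$. For a matrix $A=(a_{ij})$ with entries in $I$ write $F[A]=(F(a_{ij}))$; "positive" means real symmetric positive semidefinite, and $\mathbf 1_{N\times N}$ is the $N\times N$ matrix all of whose entries are $1$. Suppose that (i) $F[A]$ is positive for every positive $2\times2$ matrix $A$ with entries in $I$; and (ii) $F[A]$ is positive for every $N\times N$ Hankel matrix of the form $A=a\mathbf 1_{N\times N}+b\,\mathbf u\mathbf u^T$ with $a\in[0,\rho)$, $b\in[0,\rho-a)$ and $0<a+b<\rho$. Then $F\in C^{N-3}(I)$, with $F^{(k)}(x)\ge 0$ for all $x\in I$ and all integers $0\le k\le N-3$, and $F^{(N-3)}$ is convex and non-decreasing on $I$. If, further, $F\in C^{N-1}(I)$, then $F^{(k)}(x)\ge0$ for all $x\in I$ and all integers $0\le k\le N-1$. All of these conclusions remain true if hypothesis (i) is replaced by the assumption that $F$ is continuous on $I$. -/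

import Mathlib

/-- The open interval `(0, ρ)` of real numbers, for an extended real `ρ` (so `ρ = ⊤` gives
`(0, ∞)`). -/
def openInterval (ρ : EReal) : Set ℝ :=
  {x : ℝ | 0 < x ∧ (x : EReal) < ρ}

/-- The set of positive semidefinite real `n × n` matrices with all entries in `I`. -/
def posMatrices (n : ℕ) (I : Set ℝ) : Set (Matrix (Fin n) (Fin n) ℝ) :=
  {A | A.PosSemidef ∧ ∀ i j, A i j ∈ I}

/-- The vector `(1, u₀, …, u₀ ^ (N - 1))`. -/
def geomVec (N : ℕ) (u₀ : ℝ) : Fin N → ℝ :=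
  fun i => u₀ ^ (i : ℕ)

/-- The family of Hankel matrices `a 𝟏 + b u uᵀ`, where `𝟏` is the all-ones `N × N` matrix,
`u = (1, u₀, …, u₀ ^ (N - 1))`, and `a ∈ [0, ρ)`, `b ∈ [0, ρ - a)`, `0 < a + b < ρ`. -/
def hankelFamily (N : ℕ) (u₀ : ℝ) (ρ : EReal) : Set (Matrix (Fin N) (Fin N) ℝ) :=
  {A | ∃ a b : ℝ, 0 ≤ a ∧ (a : EReal) < ρ ∧ 0 ≤ b ∧ (b : EReal) < ρ - (a : EReal) ∧
    0 < a + b ∧ ((a + b : ℝ) : EReal) < ρ ∧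
    A = a • Matrix.of (fun _ _ => (1 : ℝ)) +
      b • Matrix.vecMulVec (geomVec N u₀) (geomVec N u₀)}

/-!
Positivity on the matrices `a 𝟏 + b u uᵀ` survives translation and averaging, so `F` is a limit of
mollifications which have the same property on slightly smaller intervals. For a smooth `F`, choose
`v` orthogonal to the vectors `(uᵢ ^ k)ᵢ` for all `k < N` except `k = m`: the quadratic form of
`F[a 𝟏 + b u uᵀ]` at `v` is then a positive multiple of `b ^ m F⁽ᵐ⁾(a)` to leading order as `b ↓ 0`,
whence `F⁽ᵐ⁾ ≥ 0` for `m < N`. Differentiability passes to the limit as follows: if the second and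
third derivatives are nonnegative, then the limit `f` and its increments `f (x + h) - f x`, `h > 0`,
are convex, hence so is the right derivative of `f`; it is therefore continuous, and a convex
function with continuous right derivative is differentiable. Its derivative is the limit of the
derivatives, and the argument repeats.

For `2 × 2` matrices, positivity of `F[A]` makes `F` monotone and multiplicatively midpoint convex,
which forces continuity.
-/

open Filter Topology Set MeasureTheory Matrix
open scoped ContDiff Convolution

section Limits

variable {ι : Type*} {l : Filter ι} {s : Set ℝ} {f : ℝ → ℝ} {x : ℝ}

theorem convexOn_iteratedDeriv {m : ℕ} (hs : Convex ℝ s) (hf : ContDiff ℝ (m + 2 : ℕ) f)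
    (hpos : ∀ x ∈ s, 0 ≤ iteratedDeriv (m + 2) f x) : ConvexOn ℝ s (iteratedDeriv m f) := by
  have hdiff : Differentiable ℝ (iteratedDeriv m f) :=
    hf.differentiable_iteratedDeriv m (by norm_cast; omega)
  have hdiff' : Differentiable ℝ (iteratedDeriv (m + 1) f) :=
    hf.differentiable_iteratedDeriv (m + 1) (by norm_cast; omega)
  refine convexOn_of_deriv2_nonneg' hs hdiff.differentiableOn ?_ fun x hx ↦ ?_
  · rw [← iteratedDeriv_succ]
    exact hdiff'.differentiableOn
  · rw [Function.iterate_succ_apply, Function.iterate_one, ← iteratedDeriv_succ,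
      ← iteratedDeriv_succ]
    exact hpos x hx

theorem monotoneOn_iteratedDeriv {m : ℕ} (hs : Convex ℝ s) (hf : ContDiff ℝ (m + 1 : ℕ) f)
    (hpos : ∀ x ∈ s, 0 ≤ iteratedDeriv (m + 1) f x) : MonotoneOn (iteratedDeriv m f) s := by
  have hdiff : Differentiable ℝ (iteratedDeriv m f) :=
    hf.differentiable_iteratedDeriv m (by norm_cast; omega)
  refine monotoneOn_of_deriv_nonneg hs hdiff.continuous.continuousOn hdiff.differentiableOn
    fun x hx ↦ ?_
  rw [← iteratedDeriv_succ]
  exact hpos x (interior_subset hx)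

theorem convexOn_fwdDiff {h : ℝ} (hs : Convex ℝ s) (hh : 0 ≤ h) (hf : ContDiff ℝ 3 f)
    (hpos : ∀ x ∈ s, 0 ≤ iteratedDeriv 3 f x) :
    ConvexOn ℝ (s ∩ (· + h) ⁻¹' s) (fwdDiff h f) := by
  have hmono : MonotoneOn (iteratedDeriv 2 f) s := monotoneOn_iteratedDeriv hs hf hpos
  have hf2 : ContDiff ℝ 2 f := hf.of_le (by norm_num)
  have hshift : ContDiff ℝ 2 fun x ↦ f (x + h) := hf2.comp (contDiff_id.add contDiff_const)
  rw [← iteratedDeriv_zero (f := fwdDiff h f)]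
  refine convexOn_iteratedDeriv (hs.inter (hs.translate_preimage_left h)) (hshift.sub hf2)
    fun x hx ↦ ?_
  change 0 ≤ iteratedDeriv 2 (fun y ↦ f (y + h) - f y) x
  rw [iteratedDeriv_fun_sub hshift.contDiffAt hf2.contDiffAt, iteratedDeriv_comp_add_const]
  exact sub_nonneg.2 (hmono hx.1 hx.2 (by linarith))

theorem tendsto_deriv_of_convexOn {g : ι → ℝ → ℝ} (hg : ∀ n, ConvexOn ℝ s (g n))
    (hd : ∀ n, DifferentiableAt ℝ (g n) x) (hlim : ∀ y ∈ s, Tendsto (fun n ↦ g n y) l (𝓝 (f y)))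
    (hs : s ∈ 𝓝 x) (hf : DifferentiableAt ℝ f x) :
    Tendsto (fun n ↦ deriv (g n) x) l (𝓝 (deriv f x)) := by
  have hx : x ∈ s := mem_of_mem_nhds hs
  have hmem : ∀ᶠ y in 𝓝 x, y ∈ s := hs
  have hslope {y z : ℝ} (hy : y ∈ s) (hz : z ∈ s) :
      Tendsto (fun n ↦ slope (g n) y z) l (𝓝 (slope f y z)) := by
    simp only [slope_def_field]
    exact ((hlim z hz).sub (hlim y hy)).div_const _
  obtain ⟨hleft, hright⟩ := hasDerivAt_iff_tendsto_slope_left_right.1 hf.hasDerivAt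
  refine tendsto_order.2 ⟨fun a ha ↦ ?_, fun a ha ↦ ?_⟩
  · obtain ⟨y, hay, hy, hyx⟩ := ((hleft.eventually_const_lt ha).and
      ((hmem.filter_mono nhdsWithin_le_nhds).and self_mem_nhdsWithin)).exists
    filter_upwards [(hslope hx hy).eventually_const_lt hay] with n hn
    rw [slope_comm] at hn
    exact hn.trans_le ((hg n).slope_le_deriv hy hx hyx (hd n))
  · obtain ⟨y, hya, hy, hxy⟩ := ((hright.eventually_lt_const ha).and
      ((hmem.filter_mono nhdsWithin_le_nhds).and self_mem_nhdsWithin)).exists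
    filter_upwards [(hslope hx hy).eventually_lt_const hya] with n hn
    exact ((hg n).deriv_le_slope hx hy hxy (hd n)).trans_lt hn

theorem differentiableAt_of_continuousAt_rightDeriv (hf : ConvexOn ℝ s f) (hs : s ∈ 𝓝 x)
    (hcont : ContinuousAt (fun y ↦ derivWithin f (Ioi y) y) x) : DifferentiableAt ℝ f x := by
  have hx : x ∈ interior s := mem_interior_iff_mem_nhds.2 hs
  have hle : derivWithin f (Ioi x) x ≤ derivWithin f (Iio x) x := by
    refine le_of_tendsto (hcont.tendsto.mono_left nhdsWithin_le_nhds : Tendsto _ (𝓝[<] x) _) ?_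
    filter_upwards [nhdsWithin_le_nhds (interior_mem_nhds.2 hs), self_mem_nhdsWithin] with y hy hyx
    exact (hf.rightDeriv_le_slope_of_mem_interior hy (interior_subset hx) hyx).trans
      (hf.slope_le_leftDeriv_of_mem_interior (interior_subset hy) hx hyx)
  have heq := (hf.leftDeriv_le_rightDeriv_of_mem_interior hx).antisymm hle
  have hleft := hf.hasDerivWithinAt_leftDeriv_of_mem_interior hx
  have hright := hf.hasDerivWithinAt_rightDeriv_of_mem_interior hx
  rw [hasDerivWithinAt_iff_tendsto_slope' self_notMem_Iio, heq] at hleft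
  rw [hasDerivWithinAt_iff_tendsto_slope' self_notMem_Ioi] at hright
  exact (hasDerivAt_iff_tendsto_slope_left_right.2 ⟨hleft, hright⟩).differentiableAt

theorem convexOn_rightDeriv (hs : IsOpen s) (hf : ConvexOn ℝ s f)
    (hdiff : ∀ h > 0, ConvexOn ℝ (s ∩ (· + h) ⁻¹' s) (fwdDiff h f)) :
    ConvexOn ℝ s fun x ↦ derivWithin f (Ioi x) x := by
  have hadd (x : ℝ) : Tendsto (x + ·) (𝓝[>] 0) (𝓝[>] x) :=
    (map_add_left_nhdsGT.trans (by rw [add_zero])).le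
  have hlim {x : ℝ} (hx : x ∈ s) :
      Tendsto (fun h ↦ h⁻¹ • fwdDiff h f x) (𝓝[>] 0) (𝓝 (derivWithin f (Ioi x) x)) := by
    have h := hf.hasDerivWithinAt_rightDeriv_of_mem_interior (hs.interior_eq.symm ▸ hx)
    rw [hasDerivWithinAt_iff_tendsto_slope' self_notMem_Ioi] at h
    simpa [Function.comp_def, slope, fwdDiff] using h.comp (hadd x)
  have hmem {x : ℝ} (hx : x ∈ s) : ∀ᶠ h in 𝓝[>] (0 : ℝ), x + h ∈ s :=
    hadd x (nhdsWithin_le_nhds (hs.mem_nhds hx))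
  refine ⟨hf.1, fun x hx y hy a b ha hb hab ↦ ?_⟩
  refine le_of_tendsto_of_tendsto (hlim (hf.1 hx hy ha hb hab))
    (((hlim hx).const_smul a).add ((hlim hy).const_smul b)) ?_
  filter_upwards [hmem hx, hmem hy, self_mem_nhdsWithin] with h hxh hyh hh
  exact ((hdiff h hh).smul (inv_nonneg.2 (le_of_lt hh))).2 ⟨hx, hxh⟩ ⟨hy, hyh⟩ ha hb hab

variable [l.NeBot]

theorem convexOn_of_tendsto {g : ι → ℝ → ℝ} (hs : Convex ℝ s) (hg : ∀ n, ConvexOn ℝ s (g n))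
    (hlim : ∀ x ∈ s, Tendsto (fun n ↦ g n x) l (𝓝 (f x))) : ConvexOn ℝ s f :=
  ⟨hs, fun x hx y hy _ _ ha hb hab ↦ le_of_tendsto_of_tendsto' (hlim _ (hs hx hy ha hb hab))
    (((hlim x hx).const_smul _).add ((hlim y hy).const_smul _))
    fun n ↦ (hg n).2 hx hy ha hb hab⟩

theorem differentiableAt_of_tendsto {g : ι → ℝ → ℝ} (hs : IsOpen s) (hsc : Convex ℝ s)
    (hg : ∀ n, ContDiff ℝ 3 (g n)) (hpos2 : ∀ n, ∀ x ∈ s, 0 ≤ iteratedDeriv 2 (g n) x)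
    (hpos3 : ∀ n, ∀ x ∈ s, 0 ≤ iteratedDeriv 3 (g n) x)
    (hlim : ∀ x ∈ s, Tendsto (fun n ↦ g n x) l (𝓝 (f x))) (hx : x ∈ s) :
    DifferentiableAt ℝ f x := by
  have hf : ConvexOn ℝ s f := convexOn_of_tendsto hsc
    (fun n ↦ convexOn_iteratedDeriv hsc ((hg n).of_le (by norm_num)) (hpos2 n)) hlim
  have hdiff (h : ℝ) (hh : h > 0) : ConvexOn ℝ (s ∩ (· + h) ⁻¹' s) (fwdDiff h f) :=
    convexOn_of_tendsto (hsc.inter (hsc.translate_preimage_left h))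
      (fun n ↦ convexOn_fwdDiff hsc hh.le (hg n) (hpos3 n))
      fun x hx ↦ (hlim _ hx.2).sub (hlim x hx.1)
  exact differentiableAt_of_continuousAt_rightDeriv hf (hs.mem_nhds hx)
    (((convexOn_rightDeriv hs hf hdiff).continuousOn hs).continuousAt (hs.mem_nhds hx))

theorem contDiffOn_and_tendsto_iteratedDeriv (m : ℕ) {g : ι → ℝ → ℝ} (hs : IsOpen s)
    (hsc : Convex ℝ s) (hg : ∀ n, ContDiff ℝ ∞ (g n))
    (hpos : ∀ n, ∀ k ∈ Icc 2 (m + 2), ∀ x ∈ s, 0 ≤ iteratedDeriv k (g n) x)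
    (hlim : ∀ x ∈ s, Tendsto (fun n ↦ g n x) l (𝓝 (f x))) :
    ContDiffOn ℝ m f s ∧
      ∀ x ∈ s, Tendsto (fun n ↦ iteratedDeriv m (g n) x) l (𝓝 (iteratedDeriv m f x)) := by
  induction m generalizing g f with
  | zero =>
    have hconv (n : ι) : ConvexOn ℝ s (g n) :=
      convexOn_iteratedDeriv hsc (contDiff_infty.1 (hg n) 2) (hpos n 2 (by simp))
    simpa using ⟨(convexOn_of_tendsto hsc hconv hlim).continuousOn hs, hlim⟩
  | succ m ih =>
    have hsmooth (n : ι) (k : ℕ) : ContDiff ℝ k (g n) := contDiff_infty.1 (hg n) k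
    have hdiff (x : ℝ) (hx : x ∈ s) : DifferentiableAt ℝ f x :=
      differentiableAt_of_tendsto hs hsc (hsmooth · 3) (fun n ↦ hpos n 2 (by simp))
        (fun n ↦ hpos n 3 (by simp)) hlim hx
    have hlim' (x : ℝ) (hx : x ∈ s) : Tendsto (fun n ↦ deriv (g n) x) l (𝓝 (deriv f x)) :=
      tendsto_deriv_of_convexOn
        (fun n ↦ convexOn_iteratedDeriv hsc (hsmooth n 2) (hpos n 2 (by simp)))
        (fun n ↦ (hsmooth n 1).differentiable (by simp) x) hlim (hs.mem_nhds hx) (hdiff x hx)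
    obtain ⟨hcd, htend⟩ := ih (fun n ↦ (contDiff_infty_iff_deriv.1 (hg n)).2)
      (fun n k hk x hx ↦ by
        rw [← iteratedDeriv_succ']
        exact hpos n (k + 1) (by grind) x hx) hlim'
    refine ⟨?_, by simpa only [iteratedDeriv_succ'] using htend⟩
    rw [Nat.cast_succ, contDiffOn_succ_iff_deriv_of_isOpen hs]
    exact ⟨fun x hx ↦ (hdiff x hx).differentiableWithinAt, by simp, hcd⟩

end Limits

section Derivatives

theorem iteratedDeriv_comp_add_mul {𝕜 : Type*} [NontriviallyNormedField 𝕜] (k : ℕ) (f : 𝕜 → 𝕜)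
    (a c : 𝕜) :
    iteratedDeriv k (fun t ↦ f (a + t * c)) = fun t ↦ c ^ k * iteratedDeriv k f (a + t * c) := by
  induction k with
  | zero => simp
  | succ k ih =>
    ext t
    have hderiv : deriv (fun t ↦ iteratedDeriv k f (a + t * c)) t =
        c * deriv (iteratedDeriv k f) (a + t * c) := by
      have h := deriv_comp_mul_left c (fun t ↦ iteratedDeriv k f (a + t)) t
      rw [deriv_comp_const_add, smul_eq_mul] at h
      simpa only [mul_comm c t, mul_comm c] using h
    rw [iteratedDeriv_succ, ih, deriv_const_mul_field, hderiv, ← iteratedDeriv_succ, pow_succ,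
      mul_assoc]

theorem iteratedDeriv_nonneg_of_eventually_nonneg {f : ℝ → ℝ} {a : ℝ} {m : ℕ}
    (hf : ContDiffAt ℝ m f a) (hzero : ∀ k < m, iteratedDeriv k f a = 0)
    (hnonneg : ∀ᶠ x in 𝓝[>] a, 0 ≤ f x) : 0 ≤ iteratedDeriv m f a := by
  obtain ⟨r, hr, hball⟩ := Metric.eventually_nhds_iff_ball.1 (hf.eventually (by simp))
  have ha : a ∈ Metric.ball a r := Metric.mem_ball_self hr
  have htaylor (x : ℝ) : taylorWithinEval f m (Metric.ball a r) a x =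
      (x - a) ^ m * ((m.factorial : ℝ)⁻¹ * iteratedDeriv m f a) := by
    rw [taylor_within_apply, Finset.sum_range_succ, Finset.sum_eq_zero, zero_add,
      iteratedDerivWithin_of_isOpen Metric.isOpen_ball ha, smul_eq_mul, mul_right_comm, mul_comm]
    intro k hk
    rw [iteratedDerivWithin_of_isOpen Metric.isOpen_ball ha, hzero k (Finset.mem_range.1 hk),
      smul_zero]
  have hlim : Tendsto (fun x ↦ ((x - a) ^ m)⁻¹ * f x) (𝓝[>] a)
      (𝓝 ((m.factorial : ℝ)⁻¹ * iteratedDeriv m f a)) := by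
    have h := taylor_tendsto (convex_ball a r) ha fun x hx ↦ (hball x hx).contDiffWithinAt
    rw [Metric.isOpen_ball.nhdsWithin_eq ha] at h
    refine tendsto_sub_nhds_zero_iff.1 ((h.mono_left nhdsWithin_le_nhds).congr' ?_)
    filter_upwards [self_mem_nhdsWithin] with x hx
    rw [htaylor, smul_eq_mul, mul_sub, inv_mul_cancel_left₀ (pow_pos (sub_pos.2 hx) m).ne']
  have hcoeff : 0 ≤ (m.factorial : ℝ)⁻¹ * iteratedDeriv m f a := by
    refine ge_of_tendsto hlim ?_
    filter_upwards [hnonneg, self_mem_nhdsWithin] with x hfx hx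
    exact mul_nonneg (inv_nonneg.2 (pow_nonneg (sub_nonneg.2 (le_of_lt hx)) m)) hfx
  exact nonneg_of_mul_nonneg_right hcoeff (by positivity)

theorem contDiffAt_comp_add_mul {𝕜 : Type*} [NontriviallyNormedField 𝕜] {n : WithTop ℕ∞}
    {f : 𝕜 → 𝕜} {a : 𝕜} (hf : ContDiffAt 𝕜 n f a) (c : 𝕜) :
    ContDiffAt 𝕜 n (fun t ↦ f (a + t * c)) 0 :=
  ContDiffAt.comp 0 (by simpa using hf) (by fun_prop)

theorem iteratedDeriv_sum_comp_add_mul {𝕜 ι : Type*} [NontriviallyNormedField 𝕜] [Fintype ι]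
    {f : 𝕜 → 𝕜} {a : 𝕜} {k : ℕ} (hf : ContDiffAt 𝕜 k f a) (w c : ι → 𝕜) :
    iteratedDeriv k (fun t ↦ ∑ i, w i * f (a + t * c i)) 0 =
      (∑ i, w i * c i ^ k) * iteratedDeriv k f a := by
  rw [iteratedDeriv_fun_sum fun i _ ↦ contDiffAt_const.mul (contDiffAt_comp_add_mul hf (c i)),
    Finset.sum_mul]
  refine Finset.sum_congr rfl fun i _ ↦ ?_
  simp only [iteratedDeriv_const_mul_field, iteratedDeriv_comp_add_mul, zero_mul, add_zero,
    mul_assoc]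

theorem iteratedDeriv_nonneg_of_sum_nonneg {ι : Type*} [Fintype ι] {f : ℝ → ℝ} {a : ℝ} {m : ℕ}
    (hf : ContDiffAt ℝ m f a) {w c : ι → ℝ} (hw : ∀ k < m, ∑ i, w i * c i ^ k = 0)
    (hwm : 0 < ∑ i, w i * c i ^ m)
    (hnonneg : ∀ᶠ t in 𝓝[>] (0 : ℝ), 0 ≤ ∑ i, w i * f (a + t * c i)) :
    0 ≤ iteratedDeriv m f a := by
  have hderiv {k : ℕ} (hk : k ≤ m) := iteratedDeriv_sum_comp_add_mul
    (hf.of_le (by exact_mod_cast hk : (k : WithTop ℕ∞) ≤ m)) w c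
  have hsmooth : ContDiffAt ℝ m (fun t ↦ ∑ i, w i * f (a + t * c i)) 0 :=
    ContDiffAt.sum fun i _ ↦ contDiffAt_const.mul (contDiffAt_comp_add_mul hf (c i))
  have h := iteratedDeriv_nonneg_of_eventually_nonneg hsmooth
    (fun k hk ↦ by rw [hderiv hk.le, hw k hk, zero_mul]) hnonneg
  rw [hderiv le_rfl] at h
  exact nonneg_of_mul_nonneg_right h hwm

end Derivatives

theorem exists_sum_mul_pow_eq {K : Type*} [Field K] {n : ℕ} {x : Fin n → K}
    (hx : Function.Injective x) (c : Fin n → K) :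
    ∃ v : Fin n → K, ∀ k : Fin n, ∑ i, v i * x i ^ (k : ℕ) = c k := by
  have hdet : IsUnit (vandermonde x).det := isUnit_iff_ne_zero.2 (det_vandermonde_ne_zero_iff.2 hx)
  refine ⟨c ᵥ* (vandermonde x)⁻¹, fun k ↦ ?_⟩
  have h : (c ᵥ* (vandermonde x)⁻¹) ᵥ* vandermonde x = c := by
    rw [vecMul_vecMul, nonsing_inv_mul _ hdet, vecMul_one]
  exact congrFun h k

/-- `F` preserves positivity, applied entrywise, on the matrices `a 𝟏 + b u uᵀ` with `b ≥ 0`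
and `a, a + b ∈ s`; `𝟏` is the all-ones matrix. When `u` has entries in `[0, 1]` and `s` is an
interval, all the entries `a + b uᵢ uⱼ` lie in `s`. -/
def PreservesPosOnPencil {ι : Type*} (u : ι → ℝ) (s : Set ℝ) (F : ℝ → ℝ) : Prop :=
  ∀ ⦃a b : ℝ⦄, 0 ≤ b → a ∈ s → a + b ∈ s →
    (Matrix.of fun i j ↦ F (a + b * (u i * u j))).PosSemidef

section Pencil

variable {ι : Type*} {u : ι → ℝ} {s : Set ℝ} {F : ℝ → ℝ}

theorem preservesPosOnPencil_iff [Fintype ι] :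
    PreservesPosOnPencil u s F ↔ ∀ ⦃a b : ℝ⦄, 0 ≤ b → a ∈ s → a + b ∈ s → ∀ v : ι → ℝ,
      0 ≤ ∑ p : ι × ι, v p.1 * v p.2 * F (a + b * (u p.1 * u p.2)) := by
  have hsymm (a b : ℝ) : (Matrix.of fun i j ↦ F (a + b * (u i * u j))).IsHermitian :=
    IsHermitian.ext fun i j ↦ by simp [mul_comm (u i)]
  have hsum (a b : ℝ) (v : ι → ℝ) : star v ⬝ᵥ (Matrix.of fun i j ↦ F (a + b * (u i * u j))) *ᵥ v =
      ∑ p : ι × ι, v p.1 * v p.2 * F (a + b * (u p.1 * u p.2)) := by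
    simp only [dotProduct, mulVec, star_trivial, of_apply, Finset.mul_sum, Fintype.sum_prod_type]
    exact Finset.sum_congr rfl fun i _ ↦ Finset.sum_congr rfl fun j _ ↦ by ring
  simp only [PreservesPosOnPencil, posSemidef_iff_dotProduct_mulVec, hsymm, true_and, hsum]

theorem PreservesPosOnPencil.mono {t : Set ℝ} (hF : PreservesPosOnPencil u t F) (hst : s ⊆ t) :
    PreservesPosOnPencil u s F :=
  fun _ _ hb ha hab ↦ hF hb (hst ha) (hst hab)

theorem PreservesPosOnPencil.congr {G : ℝ → ℝ} (hF : PreservesPosOnPencil u s F)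
    (hs : s.OrdConnected) (hu : ∀ i, u i ∈ Icc 0 1) (hFG : EqOn F G s) :
    PreservesPosOnPencil u s G := by
  intro a b hb ha hab
  have hentry (i j : ι) : a + b * (u i * u j) ∈ s := by
    have h : u i * u j ∈ Icc 0 1 := unitInterval.mul_mem (hu i) (hu j)
    exact hs.out ha hab ⟨by nlinarith [h.1], by nlinarith [h.2]⟩
  simpa only [hFG (hentry _ _)] using hF hb ha hab

theorem PreservesPosOnPencil.iteratedDeriv_nonneg {N m : ℕ} {u : Fin N → ℝ} {x : ℝ}
    (hF : PreservesPosOnPencil u s F) (hu : Function.Injective u) (hm : m < N) (hs : s ∈ 𝓝 x)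
    (hFx : ContDiffAt ℝ m F x) : 0 ≤ iteratedDeriv m F x := by
  obtain ⟨v, hv⟩ := exists_sum_mul_pow_eq hu (Pi.single ⟨m, hm⟩ 1)
  have hmoment {k : ℕ} (hk : k < N) : ∑ p : Fin N × Fin N, v p.1 * v p.2 * (u p.1 * u p.2) ^ k =
      if k = m then 1 else 0 := by
    calc _ = (∑ i, v i * u i ^ k) * ∑ i, v i * u i ^ k := by
          rw [Finset.sum_mul_sum, Fintype.sum_prod_type]
          simp only [mul_pow, mul_mul_mul_comm]
      _ = if k = m then 1 else 0 := by
          rw [hv ⟨k, hk⟩, Pi.single_apply]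
          simp
  refine iteratedDeriv_nonneg_of_sum_nonneg hFx (fun k hk ↦ ?_) ?_ ?_
    (w := fun p : Fin N × Fin N ↦ v p.1 * v p.2) (c := fun p ↦ u p.1 * u p.2)
  · rw [hmoment (hk.trans hm), if_neg hk.ne]
  · rw [hmoment hm, if_pos rfl]
    exact one_pos
  · have hshift : Tendsto (x + ·) (𝓝[>] 0) (𝓝 x) :=
      ((continuous_const_add x).tendsto' 0 x (add_zero x)).mono_left nhdsWithin_le_nhds
    filter_upwards [hshift hs, self_mem_nhdsWithin] with t hxt ht
    exact preservesPosOnPencil_iff.1 hF (le_of_lt ht) (mem_of_mem_nhds hs) hxt v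

theorem PreservesPosOnPencil.convolution [Finite ι] {t : Set ℝ} (φ : ContDiffBump (0 : ℝ))
    (hF : PreservesPosOnPencil u t F) (hFc : Continuous F)
    (hst : ∀ x ∈ s, ∀ y ∈ Metric.ball (0 : ℝ) φ.rOut, x - y ∈ t) :
    PreservesPosOnPencil u s (φ.normed volume ⋆[ContinuousLinearMap.lsmul ℝ ℝ] F) := by
  cases nonempty_fintype ι
  refine preservesPosOnPencil_iff.2 fun a b hb ha hab v ↦ ?_
  have hint (x : ℝ) : Integrable fun y ↦ φ.normed volume y * F (x - y) :=
    (φ.continuous_normed.mul (by fun_prop)).integrable_of_hasCompactSupport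
      φ.hasCompactSupport_normed.mul_right
  simp only [MeasureTheory.convolution, ContinuousLinearMap.lsmul_apply, smul_eq_mul,
    ← integral_const_mul]
  rw [← integral_finsetSum _ fun p _ ↦ (hint _).const_mul _]
  refine integral_nonneg fun y ↦ ?_
  have hfactor : ∑ p : ι × ι, v p.1 * v p.2 *
        (φ.normed volume y * F (a + b * (u p.1 * u p.2) - y)) =
      φ.normed volume y * ∑ p : ι × ι, v p.1 * v p.2 * F (a - y + b * (u p.1 * u p.2)) := by
    simp only [Finset.mul_sum, add_sub_right_comm, mul_left_comm]
  rw [Pi.zero_apply, hfactor]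
  by_cases hy : y ∈ Metric.ball 0 φ.rOut
  · refine mul_nonneg (φ.nonneg_normed y) (preservesPosOnPencil_iff.1 hF hb (hst a ha y hy) ?_ v)
    rw [← add_sub_right_comm]
    exact hst _ hab y hy
  · rw [← φ.support_normed_eq (μ := volume), Function.notMem_support] at hy
    rw [hy, zero_mul]

theorem PreservesPosOnPencil.exists_contDiff_tendsto [Finite ι] {A B c d : ℝ}
    (hF : PreservesPosOnPencil u (Icc A B) F) (hu : ∀ i, u i ∈ Icc 0 1)
    (hFc : ContinuousOn F (Icc A B)) (hAB : A ≤ B) (hAc : A < c) (hdB : d < B) :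
    ∃ g : ℕ → ℝ → ℝ, (∀ n, ContDiff ℝ ∞ (g n)) ∧
      (∀ n, PreservesPosOnPencil u (Ioo c d) (g n)) ∧
      ∀ x ∈ Icc A B, Tendsto (fun n ↦ g n x) atTop (𝓝 (F x)) := by
  obtain ⟨δ, hδ, hδAB⟩ : ∃ δ, 0 < δ ∧ δ ≤ min (c - A) (B - d) :=
    ⟨_, lt_min (sub_pos.2 hAc) (sub_pos.2 hdB), le_rfl⟩
  obtain ⟨hδc, hδd⟩ := le_min_iff.1 hδAB
  let φ (n : ℕ) : ContDiffBump (0 : ℝ) :=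
    ⟨δ / (n + 1) / 2, δ / (n + 1), by positivity, half_lt_self (by positivity)⟩
  have hφ (n : ℕ) : (φ n).rOut ≤ δ := div_le_self hδ.le (by simp)
  have hφlim : Tendsto (fun n ↦ (φ n).rOut) atTop (𝓝 0) :=
    tendsto_const_nhds.div_atTop (tendsto_natCast_atTop_atTop.atTop_add tendsto_const_nhds)
  let E : ℝ → ℝ := IccExtend hAB ((Icc A B).domRestrict F)
  have hEF : EqOn F E (Icc A B) := fun x hx ↦ by
    simp [E, IccExtend_of_mem hAB _ hx]
  have hE : Continuous E := hFc.domRestrict.Icc_extend'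
  refine ⟨fun n ↦ (φ n).normed volume ⋆[ContinuousLinearMap.lsmul ℝ ℝ] E,
    fun n ↦ (φ n).hasCompactSupport_normed.contDiff_convolution_left _ (φ n).contDiff_normed
      hE.locallyIntegrable,
    fun n ↦ (hF.congr ordConnected_Icc hu hEF).convolution (φ n) hE fun x hx y hy ↦ ?_,
    fun x hx ↦ hEF hx ▸ ContDiffBump.convolution_tendsto_right_of_continuous hφlim hE x⟩
  rw [mem_ball_zero_iff, Real.norm_eq_abs, abs_lt] at hy
  exact ⟨by linarith [hx.1, hφ n], by linarith [hx.2, hφ n]⟩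

end Pencil

section Interval

variable {N m : ℕ} {u : Fin N → ℝ} {s : Set ℝ} {F : ℝ → ℝ}

theorem PreservesPosOnPencil.contDiffOn_and_convexOn_and_monotoneOn_Ioo
    (hF : PreservesPosOnPencil u s F) (hu : Function.Injective u) (hu01 : ∀ i, u i ∈ Icc 0 1)
    (hm : m + 2 < N) (hs : IsOpen s) (hsc : s.OrdConnected) (hFc : ContinuousOn F s) {c d : ℝ}
    (hc : c ∈ s) (hd : d ∈ s) (hcd : c ≤ d) :
    ContDiffOn ℝ m F (Ioo c d) ∧ ConvexOn ℝ (Ioo c d) (iteratedDeriv m F) ∧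
      MonotoneOn (iteratedDeriv m F) (Ioo c d) := by
  obtain ⟨A, hAc, hA⟩ := (hs.eventually_mem hc).exists_lt
  obtain ⟨B, hdB, hB⟩ := (hs.eventually_mem hd).exists_gt
  have hsub : Icc A B ⊆ s := hsc.out hA hB
  obtain ⟨g, hg, hgpos, hlim⟩ := (hF.mono hsub).exists_contDiff_tendsto hu01 (hFc.mono hsub)
    ((hAc.trans_le hcd).trans hdB).le hAc hdB
  have hderiv (n k : ℕ) (hk : k < N) (x : ℝ) (hx : x ∈ Ioo c d) : 0 ≤ iteratedDeriv k (g n) x :=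
    (hgpos n).iteratedDeriv_nonneg hu hk (isOpen_Ioo.mem_nhds hx)
      (contDiff_infty.1 (hg n) k).contDiffAt
  obtain ⟨hsmooth, hlim'⟩ := contDiffOn_and_tendsto_iteratedDeriv m isOpen_Ioo (convex_Ioo c d) hg
    (fun n k hk ↦ hderiv n k (hk.2.trans_lt hm))
    fun x hx ↦ hlim x (Icc_subset_Icc hAc.le hdB.le (Ioo_subset_Icc_self hx))
  refine ⟨hsmooth, ?_, ?_⟩
  · exact convexOn_of_tendsto (convex_Ioo c d) (fun n ↦ convexOn_iteratedDeriv (convex_Ioo c d)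
      (contDiff_infty.1 (hg n) _) (hderiv n _ hm)) hlim'
  · exact monotoneOn_of_frequently_monotoneOn_of_tendsto (.of_forall fun n ↦
      monotoneOn_iteratedDeriv (convex_Ioo c d) (contDiff_infty.1 (hg n) _)
        (hderiv n _ (by omega))) hlim'

theorem exists_mem_Ioo_of_isOpen {s : Set ℝ} (hs : IsOpen s) {x y : ℝ} (hx : x ∈ s) (hy : y ∈ s) :
    ∃ c ∈ s, ∃ d ∈ s, x ∈ Ioo c d ∧ y ∈ Ioo c d := by
  obtain ⟨c, hc, hcs⟩ := (hs.eventually_mem (min_rec' (· ∈ s) hx hy)).exists_lt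
  obtain ⟨d, hd, hds⟩ := (hs.eventually_mem (max_rec' (· ∈ s) hx hy)).exists_gt
  rw [lt_min_iff] at hc
  rw [max_lt_iff] at hd
  exact ⟨c, hcs, d, hds, ⟨hc.1, hd.1⟩, hc.2, hd.2⟩

theorem PreservesPosOnPencil.contDiffOn_and_convexOn_and_monotoneOn
    (hF : PreservesPosOnPencil u s F) (hu : Function.Injective u) (hu01 : ∀ i, u i ∈ Icc 0 1)
    (hm : m + 2 < N) (hs : IsOpen s) (hsc : s.OrdConnected) (hFc : ContinuousOn F s) :
    ContDiffOn ℝ m F s ∧ ConvexOn ℝ s (iteratedDeriv m F) ∧ MonotoneOn (iteratedDeriv m F) s := by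
  have hlocal {c d x : ℝ} (hc : c ∈ s) (hd : d ∈ s) (hx : x ∈ Ioo c d) :=
    hF.contDiffOn_and_convexOn_and_monotoneOn_Ioo hu hu01 hm hs hsc hFc hc hd (hx.1.trans hx.2).le
  refine ⟨fun x hx ↦ ?_, ⟨hsc.convex, fun x hx y hy a b ha hb hab ↦ ?_⟩, fun x hx y hy hxy ↦ ?_⟩
  · obtain ⟨c, hc, d, hd, hxcd, -⟩ := exists_mem_Ioo_of_isOpen hs hx hx
    exact ((hlocal hc hd hxcd).1.contDiffAt (isOpen_Ioo.mem_nhds hxcd)).contDiffWithinAt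
  · obtain ⟨c, hc, d, hd, hxcd, hycd⟩ := exists_mem_Ioo_of_isOpen hs hx hy
    exact (hlocal hc hd hxcd).2.1.2 hxcd hycd ha hb hab
  · obtain ⟨c, hc, d, hd, hxcd, hycd⟩ := exists_mem_Ioo_of_isOpen hs hx hy
    exact (hlocal hc hd hxcd).2.2 hxcd hycd hxy

end Interval

theorem posSemidef_fin_two_iff {x y z : ℝ} :
    (!![x, y; y, z] : Matrix (Fin 2) (Fin 2) ℝ).PosSemidef ↔ 0 ≤ x ∧ 0 ≤ z ∧ y ^ 2 ≤ x * z := by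
  refine ⟨fun h ↦ ⟨h.diag_nonneg (i := 0), h.diag_nonneg (i := 1), ?_⟩, fun ⟨hx, hz, hy⟩ ↦ ?_⟩
  · have hdet := h.det_nonneg
    rw [det_fin_two_of] at hdet
    nlinarith
  · refine .of_dotProduct_mulVec_nonneg ?_ fun v ↦ ?_
    · ext i j
      fin_cases i <;> fin_cases j <;> simp
    · suffices 0 ≤ x * v 0 ^ 2 + 2 * y * (v 0 * v 1) + z * v 1 ^ 2 by
        simp only [dotProduct, mulVec, Fin.sum_univ_two, star_trivial, of_apply, cons_val_zero,
          cons_val_one, cons_val', cons_val_fin_one]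
        linarith
      rcases hx.eq_or_lt with rfl | hx
      · obtain rfl : y = 0 := by nlinarith
        nlinarith [mul_nonneg hz (sq_nonneg (v 1))]
      · refine (mul_nonneg_iff_of_pos_left hx).1 ?_
        nlinarith [sq_nonneg (x * v 0 + y * v 1), mul_nonneg (sub_nonneg.2 hy) (sq_nonneg (v 1))]

section TwoByTwo

variable {s : Set ℝ} {F : ℝ → ℝ} {x y z : ℝ}

theorem nonneg_and_sq_le_mul_of_posMatrices
    (hF : ∀ A ∈ posMatrices 2 s, A.map F ∈ posMatrices 2 univ) (hs0 : s ⊆ Ioi 0) (hx : x ∈ s)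
    (hy : y ∈ s) (hz : z ∈ s) (h : y ^ 2 ≤ x * z) : 0 ≤ F x ∧ F y ^ 2 ≤ F x * F z := by
  have hmem : !![x, y; y, z] ∈ posMatrices 2 s :=
    ⟨posSemidef_fin_two_iff.2 ⟨(hs0 hx).le, (hs0 hz).le, h⟩, fun i j ↦ by
      fin_cases i <;> fin_cases j <;> simpa⟩
  have hmap : (!![x, y; y, z] : Matrix (Fin 2) (Fin 2) ℝ).map F = !![F x, F y; F y, F z] := by
    ext i j
    fin_cases i <;> fin_cases j <;> rfl
  have h := (hF _ hmem).1
  rw [hmap, posSemidef_fin_two_iff] at h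
  exact ⟨h.1, h.2.2⟩

theorem monotoneOn_of_posMatrices (hF : ∀ A ∈ posMatrices 2 s, A.map F ∈ posMatrices 2 univ)
    (hs0 : s ⊆ Ioi 0) : MonotoneOn F s := by
  intro x hx y hy hxy
  obtain ⟨hFy, hsq⟩ := nonneg_and_sq_le_mul_of_posMatrices hF hs0 hy hx hy
    (by rw [← sq]; exact pow_le_pow_left₀ (hs0 hx).le hxy 2)
  exact le_of_sq_le_sq (by rwa [sq (F y)]) hFy

theorem tendsto_sq_div_nhdsGT (hx : 0 < x) : Tendsto (fun y ↦ y ^ 2 / x) (𝓝[>] x) (𝓝[>] x) := by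
  have hcont : Continuous fun y ↦ y ^ 2 / x := (continuous_pow 2).div_const x
  have hfix : x ^ 2 / x = x := by rw [sq, mul_self_div_self]
  refine tendsto_nhdsWithin_iff.2 ⟨(hcont.tendsto' x x hfix).mono_left nhdsWithin_le_nhds, ?_⟩
  filter_upwards [self_mem_nhdsWithin] with y (hy : x < y)
  rw [mem_Ioi, lt_div_iff₀ hx, ← sq]
  exact pow_lt_pow_left₀ hy hx.le two_ne_zero

theorem tendsto_sq_div_nhdsLT (hx : 0 < x) : Tendsto (fun y ↦ x ^ 2 / y) (𝓝[<] x) (𝓝[>] x) := by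
  have hcont : ContinuousAt (fun y ↦ x ^ 2 / y) x := continuousAt_const.div continuousAt_id hx.ne'
  have hfix : x ^ 2 / x = x := by rw [sq, mul_self_div_self]
  rw [ContinuousAt, hfix] at hcont
  refine tendsto_nhdsWithin_iff.2 ⟨hcont.mono_left nhdsWithin_le_nhds, ?_⟩
  filter_upwards [nhdsWithin_le_nhds (lt_mem_nhds hx), self_mem_nhdsWithin] with y hy hyx
  rw [mem_Ioi, lt_div_iff₀ hy, sq]
  exact mul_lt_mul_of_pos_left hyx hx

theorem continuousWithinAt_Ioi_of_posMatrices
    (hF : ∀ A ∈ posMatrices 2 s, A.map F ∈ posMatrices 2 univ) (hs0 : s ⊆ Ioi 0) (hs : s ∈ 𝓝 x) :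
    ContinuousWithinAt F (Ioi x) x := by
  have hx : x ∈ s := mem_of_mem_nhds hs
  have hmono : MonotoneOn F s := monotoneOn_of_posMatrices hF hs0
  have hnear : ∀ᶠ y in 𝓝[>] x, y ∈ s := nhdsWithin_le_nhds hs
  obtain ⟨b, hxb, hb⟩ := mem_nhdsGT_iff_exists_Ioo_subset.1 hnear
  obtain ⟨R, hR⟩ : ∃ R, Tendsto F (𝓝[>] x) (𝓝 R) :=
    ⟨_, (hmono.mono hb).tendsto_nhdsWithin_Ioo_right (nonempty_Ioo.2 hxb)
      ⟨F x, forall_mem_image.2 fun y hy ↦ hmono hx (hb hy) hy.1.le⟩⟩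
  have hle : F x ≤ R := by
    refine ge_of_tendsto hR ?_
    filter_upwards [hnear, self_mem_nhdsWithin] with y hy hxy using hmono hx hy (le_of_lt hxy)
  -- The matrix is `!![x, y; y, y ^ 2 / x]`, with `y ↓ x`.
  have hlim := tendsto_sq_div_nhdsGT (hs0 hx)
  have hsq : R ^ 2 ≤ F x * R := by
    refine le_of_tendsto_of_tendsto (hR.pow 2) ((hR.comp hlim).const_mul (F x)) ?_
    filter_upwards [hnear, hlim.eventually hnear] with y hy hy'
    exact (nonneg_and_sq_le_mul_of_posMatrices hF hs0 hx hy hy'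
      (mul_div_cancel₀ _ (hs0 hx).ne').ge).2
  have hFx : 0 ≤ F x := (nonneg_and_sq_le_mul_of_posMatrices hF hs0 hx hx hx (sq x).le).1
  rwa [ContinuousWithinAt, show F x = R by nlinarith]

theorem continuousWithinAt_Iio_of_posMatrices
    (hF : ∀ A ∈ posMatrices 2 s, A.map F ∈ posMatrices 2 univ) (hs0 : s ⊆ Ioi 0) (hs : s ∈ 𝓝 x) :
    ContinuousWithinAt F (Iio x) x := by
  have hx : x ∈ s := mem_of_mem_nhds hs
  have hmono : MonotoneOn F s := monotoneOn_of_posMatrices hF hs0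
  have hnear : ∀ᶠ y in 𝓝[<] x, y ∈ s := nhdsWithin_le_nhds hs
  obtain ⟨a, hax, ha⟩ := mem_nhdsLT_iff_exists_Ioo_subset.1 hnear
  obtain ⟨L, hL⟩ : ∃ L, Tendsto F (𝓝[<] x) (𝓝 L) :=
    ⟨_, (hmono.mono ha).tendsto_nhdsWithin_Ioo_left (nonempty_Ioo.2 hax)
      ⟨F x, forall_mem_image.2 fun y hy ↦ hmono (ha hy) hx hy.2.le⟩⟩
  have hle : L ≤ F x := by
    refine le_of_tendsto hL ?_
    filter_upwards [hnear, self_mem_nhdsWithin] with y hy hyx using hmono hy hx (le_of_lt hyx)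
  have hpos {y : ℝ} (hy : y ∈ s) : 0 ≤ F y :=
    (nonneg_and_sq_le_mul_of_posMatrices hF hs0 hy hy hy (sq y).le).1
  -- The matrix is `!![y, x; x, x ^ 2 / y]`, with `y ↑ x`, so that `x ^ 2 / y ↓ x`.
  have hlim := tendsto_sq_div_nhdsLT (hs0 hx)
  have hsq : F x ^ 2 ≤ L * F x := by
    have hright : Tendsto F (𝓝[>] x) (𝓝 (F x)) := continuousWithinAt_Ioi_of_posMatrices hF hs0 hs
    refine ge_of_tendsto (hL.mul (hright.comp hlim)) ?_
    filter_upwards [hnear, hlim.eventually (nhdsWithin_le_nhds hs)] with y hy hy'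
    exact (nonneg_and_sq_le_mul_of_posMatrices hF hs0 hy hx hy'
      (mul_div_cancel₀ _ (hs0 hy).ne').ge).2
  have hL0 : 0 ≤ L := ge_of_tendsto hL (hnear.mono fun y hy ↦ hpos hy)
  rwa [ContinuousWithinAt, show F x = L by nlinarith]

theorem continuousOn_of_posMatrices
    (hF : ∀ A ∈ posMatrices 2 s, A.map F ∈ posMatrices 2 univ) (hs0 : s ⊆ Ioi 0) (hs : IsOpen s) :
    ContinuousOn F s := fun _ hx ↦
  (continuousAt_iff_continuous_left'_right'.2
    ⟨continuousWithinAt_Iio_of_posMatrices hF hs0 (hs.mem_nhds hx),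
      continuousWithinAt_Ioi_of_posMatrices hF hs0 (hs.mem_nhds hx)⟩).continuousWithinAt

end TwoByTwo

theorem isOpen_openInterval (ρ : EReal) : IsOpen (openInterval ρ) :=
  isOpen_Ioi.inter (isOpen_Iio.preimage continuous_coe_real_ereal)

theorem ordConnected_openInterval (ρ : EReal) : (openInterval ρ).OrdConnected :=
  ⟨fun _ hx _ hy _ hz ↦ ⟨hx.1.trans_le hz.1, (EReal.coe_le_coe_iff.2 hz.2).trans_lt hy.2⟩⟩

section Hankel

variable {N : ℕ} {u₀ : ℝ}

theorem geomVec_injective (hu₀ : u₀ ∈ Ioo 0 1) : Function.Injective (geomVec N u₀) :=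
  fun _ _ h ↦ Fin.ext (pow_right_injective₀ hu₀.1 hu₀.2.ne h)

theorem geomVec_mem_Icc (hu₀ : u₀ ∈ Icc 0 1) (i : Fin N) : geomVec N u₀ i ∈ Icc 0 1 :=
  ⟨pow_nonneg hu₀.1 _, pow_le_one₀ hu₀.1 hu₀.2⟩

theorem preservesPosOnPencil_of_hankelFamily {F : ℝ → ℝ} {ρ : EReal}
    (hF : ∀ A ∈ hankelFamily N u₀ ρ, A.map F ∈ posMatrices N univ) :
    PreservesPosOnPencil (geomVec N u₀) (openInterval ρ) F := by
  intro a b hb ha hab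
  have hbρ : (b : EReal) < ρ - a := by
    rw [EReal.lt_sub_iff_add_lt (by simp) (by simp), add_comm, ← EReal.coe_add]
    exact hab.2
  have hmap : (a • Matrix.of (fun _ _ : Fin N ↦ (1 : ℝ)) +
      b • vecMulVec (geomVec N u₀) (geomVec N u₀)).map F =
      Matrix.of fun i j ↦ F (a + b * (geomVec N u₀ i * geomVec N u₀ j)) := by
    ext i j
    simp [vecMulVec_apply]
  exact hmap ▸ (hF _ ⟨a, b, ha.1.le, ha.2, hb, hbρ, hab.1, hab.2, rfl⟩).1

end Hankel

theorem theorem3p5_general {F : ℝ → ℝ} {s : Set ℝ} {N : ℕ} {u : Fin N → ℝ} (hs : IsOpen s)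
    (hsc : s.OrdConnected) (hN : 3 ≤ N) (hu : Function.Injective u) (hu01 : ∀ i, u i ∈ Icc 0 1)
    (hFc : ContinuousOn F s) (hF : PreservesPosOnPencil u s F) :
    ContDiffOn ℝ (N - 3 : ℕ) F s ∧
    (∀ x ∈ s, ∀ k ≤ N - 3, 0 ≤ iteratedDerivWithin k F s x) ∧
    ConvexOn ℝ s (iteratedDerivWithin (N - 3) F s) ∧
    MonotoneOn (iteratedDerivWithin (N - 3) F s) s ∧
    (ContDiffOn ℝ (N - 1 : ℕ) F s → ∀ x ∈ s, ∀ k ≤ N - 1, 0 ≤ iteratedDerivWithin k F s x) := by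
  have heq (k : ℕ) : EqOn (iteratedDeriv k F) (iteratedDerivWithin k F s) s :=
    (iteratedDerivWithin_of_isOpen hs).symm
  have hnonneg {n : ℕ} (hn : n < N) (hFn : ContDiffOn ℝ n F s) (x : ℝ) (hx : x ∈ s) (k : ℕ)
      (hk : k ≤ n) : 0 ≤ iteratedDerivWithin k F s x := by
    rw [← heq k hx]
    exact hF.iteratedDeriv_nonneg hu (hk.trans_lt hn) (hs.mem_nhds hx)
      ((hFn.of_le (by exact_mod_cast hk)).contDiffAt (hs.mem_nhds hx))
  obtain ⟨hsmooth, hconv, hmono⟩ := hF.contDiffOn_and_convexOn_and_monotoneOn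
    (m := N - 3) hu hu01 (by omega) hs hsc hFc
  exact ⟨hsmooth, hnonneg (by omega) hsmooth, hconv.congr (heq _), hmono.congr (heq _),
    hnonneg (by omega)⟩

/-- The function on `(0, ρ)` is given by the values on `(0, ρ)` of `F : ℝ → ℝ`; no other value of
`F` enters the hypotheses or the conclusion. `A.map F` is the entrywise image of `A`. -/
theorem theorem3p5 (F : ℝ → ℝ) (ρ : EReal) (hρ : 0 < ρ) (u₀ : ℝ) (hu₀ : u₀ ∈ Set.Ioo (0 : ℝ) 1)
    (N : ℕ) (hN : 3 ≤ N)
    (hF : (∀ A ∈ posMatrices 2 (openInterval ρ), A.map F ∈ posMatrices 2 Set.univ) ∨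
      ContinuousOn F (openInterval ρ))
    (hH : ∀ A ∈ hankelFamily N u₀ ρ, A.map F ∈ posMatrices N Set.univ) :
    ContDiffOn ℝ ((N - 3 : ℕ) : WithTop ℕ∞) F (openInterval ρ) ∧
    (∀ x ∈ openInterval ρ, ∀ k : ℕ, k ≤ N - 3 →
      0 ≤ iteratedDerivWithin k F (openInterval ρ) x) ∧
    ConvexOn ℝ (openInterval ρ) (iteratedDerivWithin (N - 3) F (openInterval ρ)) ∧
    MonotoneOn (iteratedDerivWithin (N - 3) F (openInterval ρ)) (openInterval ρ) ∧
    (ContDiffOn ℝ ((N - 1 : ℕ) : WithTop ℕ∞) F (openInterval ρ) →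
      ∀ x ∈ openInterval ρ, ∀ k : ℕ, k ≤ N - 1 →
        0 ≤ iteratedDerivWithin k F (openInterval ρ) x) :=
  theorem3p5_general (isOpen_openInterval ρ) (ordConnected_openInterval ρ) hN
    (geomVec_injective hu₀) (geomVec_mem_Icc (Ioo_subset_Icc_self hu₀))
    (hF.elim (continuousOn_of_posMatrices · (fun _ hx ↦ hx.1) (isOpen_openInterval ρ)) id)
    (preservesPosOnPencil_of_hankelFamily hH)
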